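/- Let $(P,\le)=(P,\wedge,\vee)$ be a lattice. A finite set $S\subseteq P$ is \emph{meet closed} if $x\wedge y\in S$ for all $x,y\in S$; we write $\mu_S$ for the Möbius function of the poset $(S,\le)$. Let $\mathcal F$ be the set of functions $f:P\to\mathbb C$ with $f(x)\ne 0$ for all $x\in P$ that are semimultiplicative, i.e. $f(x)f(y)=f(x\wedge y)f(x\vee y)$ for all $x,y\in P$. For $f\in\mathcal F$ and $z\in S$ put $$\Big(\frac1f *_S\mu_S\Big)(z)=\sum_{w\in S,\;w\le z}\frac{\mu_S(w,z)}{f(w)}.$$ For an integer $k\ge 1$ let $\mathcal F_k$ be the set of all $f\in\mathcal F$ with the following property: whenever $S=\{x_1,\dots,x_n\}$ is a meet closed set, listed without repetition so that $x_i<x_j$ implies $i<j$, and for every $i$ the element $x_i$ covers at most $k$ elements of $\{x_1,\dots,x_{i-1}\}$ in the poset $\{x_1,\dots,x_i\}$, then $(\frac1f*_S\mu_S)(x_i)\neq 0$ for all $i=1,\dots,n$. Let $\mathcal S_{3,5},\mathcal S_{3,6},\mathcal S_{3,7},\mathcal S_{4,6},\mathcal S_{4,7}^{(1)},\mathcal S_{4,7}^{(2)},\mathcal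 S_{5,7}$ be the classes of meet closed sets $S=\{x_1,\dots,x_n\}\subseteq P$ with $n=5,6,7,6,7,7,7$ distinct elements, respectively, in which the covering relations ($a\lessdot b$ means that $b$ covers $a$ in $S$) are exactly * $\mathcal S_{3,5}$: $x_1\lessdot x_i\lessdot x_5$ for $i=2,3,4$; * $\mathcal S_{3,6}$: $x_1\lessdot x_2,x_3$; $x_2\lessdot x_4,x_5$; $x_3,x_4,x_5\lessdot x_6$; * $\mathcal S_{3,7}$: $x_1\lessdot x_2,x_3$; $x_2\lessdot x_4,x_5$; $x_3\lessdot x_5,x_6$; $x_4,x_5,x_6\lessdot x_7$; * $\mathcal S_{4,6}$: $x_1\lessdot x_i\lessdot x_6$ for $i=2,3,4,5$; * $\mathcal S_{4,7}^{(1)}$: $x_1\lessdot x_2,x_3$; $x_2\lessdot x_4,x_5,x_6$; $x_3,x_4,x_5,x_6\lessdot x_7$; * $\mathcal S_{4,7}^{(2)}$: $x_1\lessdot x_2,x_3,x_4$; $x_2\lessdot x_5,x_6$; $x_3,x_4,x_5,x_6\lessdot x_7$; * $\mathcal S_{5,7}$: $x_1\lessdot x_i\lessdot x_7$ for $i=2,3,4,5,6$.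 For each of these classes let $\mathcal G_{k,n}$ (respectively $\mathcal G_{4,7}^{(j)}$) be the set of all $f\in\mathcal F$ such that $(\frac1f*_S\mu_S)(x_n)\ne 0$ for every $S$ in $\mathcal S_{k,n}$ (respectively $\mathcal S_{4,7}^{(j)}$). **Corollary.** If $S$ is a meet closed subset of $P$ with $7$ elements and $$f\in\mathcal F_2\cap\mathcal G_{3,5}\cap\mathcal G_{3,6}\cap\mathcal G_{3,7}\cap\mathcal G_{4,6}\cap\mathcal G_{4,7}^{(1)}\cap\mathcal G_{4,7}^{(2)}\cap\mathcal G_{5,7},$$ then the join matrix $[S]_f=\big(f(x\vee y)\big)_{x,y\in S}$ is invertible. In particular, if $S$ is a set of $7$ positive integers that is gcd-closed (i.e. $\gcd(a,b)\in S$ for all $a,b\in S$), then the LCM matrix $[S]=\big(\operatorname{lcm}(a,b)\big)_{a,b\in S}$ is invertible. -/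

import Mathlib

noncomputable section

namespace BourqueLigh

variable {P : Type*} [Lattice P]

/-- The class `F` of semimultiplicative functions on `P` without zeros. -/
def classF (P : Type*) [Lattice P] : Set (P → ℂ) :=
  {f | (∀ x y, f x * f y = f (x ⊓ y) * f (x ⊔ y)) ∧ ∀ x, f x ≠ 0}

/-- The join matrix `[S]_f`, with entries `f (x ⊔ y)`, indexed by the elements of `S`. -/
def joinMatrix (f : P → ℂ) (S : Finset P) : Matrix S S ℂ :=
  Matrix.of fun x y => f ((x : P) ⊔ (y : P))

open Classical in
/-- The Möbius function of the finite poset `(S, ≤)`. -/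
def mobius (S : Finset P) : IncidenceAlgebra ℂ S :=
  letI : LocallyFiniteOrder S := Fintype.toLocallyFiniteOrder
  IncidenceAlgebra.mu ℂ

open Classical in
/-- The value at `z ∈ S` of the convolution over `S` of `1 / f` and the Möbius function
of `S`: the sum of `(1 / f w) * μ_S (w, z)` over `w ∈ S` with `w ≤ z`. -/
def convMobius (f : P → ℂ) (S : Finset P) (z : S) : ℂ :=
  ∑ w : S with w ≤ z, (1 / f w) * mobius S w z

/-- `x` lists the elements of `S` in such a way that `x i < x j` implies `i < j`. -/
def IsAdmissible {n : ℕ} {S : Finset P} (x : Fin n ≃ S) : Prop :=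
  ∀ i j, x i < x j → i < j

open Classical in
/-- The number of the method by which `x i` is added to the elements listed before it: the number
of those elements that `x i` covers in the set of the `x k` with `k ≤ i`. -/
def methodNumber {n : ℕ} {S : Finset P} (x : Fin n ≃ S) (i : Fin n) : ℕ :=
  (Finset.univ.filter fun j : Fin n =>
    j < i ∧ x j < x i ∧ ¬ ∃ k : Fin n, k ≤ i ∧ x j < x k ∧ x k < x i).card

/-- The class `F_k`: whenever a meet closed set is built up, element by element, by methods with
numbers at most `k`, the convolution of `1 / f` and the Möbius function vanishes at no element. -/
def classFk (P : Type*) [Lattice P] (k : ℕ) : Set (P → ℂ) :=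
  {f | f ∈ classF P ∧
    ∀ S : Finset P, InfClosed (S : Set P) →
      ∀ (n : ℕ) (x : Fin n ≃ S), IsAdmissible x → (∀ i, methodNumber x i ≤ k) →
        ∀ i, convMobius f S (x i) ≠ 0}

/-- A Hasse diagram on the vertices `0, …, n - 1`: the pairs `(i, j)` such that `j` covers `i`. -/
abbrev Diagram (n : ℕ) := Finset (Fin n × Fin n)

/-- `x` identifies `E` with the Hasse diagram of the poset `(S, ≤)`. -/
def IsLabelling {n : ℕ} (E : Diagram n) {S : Finset P} (x : Fin n ≃ S) : Prop :=
  ∀ i j, x i ⋖ x j ↔ (i, j) ∈ E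

/-- The class `G` belonging to the Hasse diagram `E`: for every meet closed set with this diagram,
the convolution of `1 / f` and the Möbius function is nonzero at the element with the last label. -/
def classG (P : Type*) [Lattice P] {m : ℕ} (E : Diagram (m + 1)) : Set (P → ℂ) :=
  {f | f ∈ classF P ∧
    ∀ S : Finset P, InfClosed (S : Set P) →
      ∀ x : Fin (m + 1) ≃ S, IsLabelling E x → convMobius f S (x (Fin.last m)) ≠ 0}

/-- Three atoms below the top. -/
def diagram35 : Diagram 5 :=
  {(0, 1), (0, 2), (0, 3), (1, 4), (2, 4), (3, 4)}

/-- Three coatoms `2, 3, 4`; `3` and `4` meet in the atom `1`, the other meets are `0`. -/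
def diagram36 : Diagram 6 :=
  {(0, 1), (0, 2), (1, 3), (1, 4), (2, 5), (3, 5), (4, 5)}

/-- Three coatoms `3, 4, 5`; `3` and `4` meet in the atom `1`, `4` and `5` in the atom `2`, and
`3` and `5` in `0`. -/
def diagram37 : Diagram 7 :=
  {(0, 1), (0, 2), (1, 3), (1, 4), (2, 4), (2, 5), (3, 6), (4, 6), (5, 6)}

/-- Four atoms below the top. -/
def diagram46 : Diagram 6 :=
  {(0, 1), (0, 2), (0, 3), (0, 4), (1, 5), (2, 5), (3, 5), (4, 5)}

/-- Four coatoms `2, 3, 4, 5`; three of them (`3, 4, 5`) meet pairwise in the atom `1`, the other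
meets are `0`. -/
def diagram47a : Diagram 7 :=
  {(0, 1), (0, 2), (1, 3), (1, 4), (1, 5), (2, 6), (3, 6), (4, 6), (5, 6)}

/-- Four coatoms `2, 3, 4, 5`; two of them (`4, 5`) meet in the atom `1`, the other meets
are `0`. -/
def diagram47b : Diagram 7 :=
  {(0, 1), (0, 2), (0, 3), (1, 4), (1, 5), (2, 6), (3, 6), (4, 6), (5, 6)}

/-- Five atoms below the top. -/
def diagram57 : Diagram 7 :=
  {(0, 1), (0, 2), (0, 3), (0, 4), (0, 5), (1, 6), (2, 6), (3, 6), (4, 6), (5, 6)}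

/-- The LCM matrix `[S]` of a finite set of natural numbers. -/
def lcmMatrix (S : Finset ℕ) : Matrix S S ℂ :=
  Matrix.of fun a b => ((Nat.lcm a b : ℕ) : ℂ)

end BourqueLigh

end

/-! Semimultiplicativity gives `f (x ⊔ y) = f x * (1 / f (x ⊓ y)) * f y`, and Möbius inversion on
`S` writes `1 / f (x ⊓ y)` as the sum of `convMobius f S w` over the common lower bounds `w` of `x`
and `y` in `S`. The join matrix is therefore a product of invertible factors and a diagonal matrix
with entries `convMobius f S z` (`isUnit_joinMatrix`), and it remains to see that none of these
entries is zero.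

The entry at `z` is local: `S` may be replaced by any meet closed subset that contains `z` and all
elements covered by `z` (`convMobius_eq_of_subset`). When `S` has at most seven elements, `z`, its
coatoms and some of their meets form such a subset with one of ten Hasse diagrams. Three of them
have at most two lower covers at each vertex and are governed by `F_2`; the other seven are those of
the classes `G`. The case analysis is `convMobius_ne_zero_of_card_le`.

For LCM matrices, `f` is the inclusion of the positive integers under divisibility. In each of the
ten diagrams the entry is an explicit integer combination of reciprocals `1 / x i`, which at least
halve along every edge, and this forces a definite sign. -/

namespace BourqueLigh

variable {P : Type*} [Lattice P]

/-! ### Möbius inversion on a meet closed set and factorization of the join matrix. -/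

section Convolution

open Classical in
/-- A function on a finite poset is determined by its sums over the principal ideals. -/
theorem eq_of_sum_le_eq {α : Type*} [Fintype α] [PartialOrder α] {g h : α → ℂ}
    (H : ∀ z, ∑ w with w ≤ z, g w = ∑ w with w ≤ z, h w) : g = h := by
  have split : ∀ (k : α → ℂ) (z : α),
      ∑ w with w ≤ z, k w = k z + ∑ w with w < z, k w := by
    intro k z
    rw [← Finset.sum_insert (by simp)]
    congr 1
    ext w
    simp [le_iff_eq_or_lt]
  funext z
  induction z using WellFoundedLT.induction with
  | ind z ih =>
    have hz := H z
    rw [split, split, Finset.sum_congr rfl fun w hw => ih w (by simpa using hw)] at hz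
    exact add_right_cancel hz

-- This Möbius inversion formula, together with `eq_of_sum_le_eq`, characterizes `convMobius`; the
-- Möbius function itself is not used afterwards.
open Classical in
theorem sum_convMobius_le (f : P → ℂ) (S : Finset P) (z : S) :
    ∑ v : S with v ≤ z, convMobius f S v = 1 / f z := by
  let _ : LocallyFiniteOrder S := Fintype.toLocallyFiniteOrder
  have key : ∀ w : S, ∑ v : S with w ≤ v ∧ v ≤ z, mobius S w v = if w = z then 1 else 0 := by
    intro w
    rw [← IncidenceAlgebra.sum_Icc_mu_right (𝕜 := ℂ) w z]
    refine Finset.sum_congr (by ext; simp) fun v _ => rfl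
  calc ∑ v : S with v ≤ z, convMobius f S v
      = ∑ v : S, ∑ w : S, if w ≤ v ∧ v ≤ z then (1 / f w) * mobius S w v else 0 := by
        simp only [convMobius, Finset.sum_filter]
        refine Finset.sum_congr rfl fun v _ => ?_
        by_cases hv : v ≤ z <;> simp [hv]
    _ = ∑ w : S, (1 / f w) * ∑ v : S with w ≤ v ∧ v ≤ z, mobius S w v := by
        rw [Finset.sum_comm]
        simp only [Finset.mul_sum, Finset.sum_filter, mul_ite, mul_zero]
    _ = 1 / f z := by simp_rw [key]; simp

open Classical in
/-- The value of the convolution at `z` depends only on a meet closed subset that contains `z` and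
dominates all elements below `z`. -/
theorem convMobius_eq_of_subset (f : P → ℂ) {S T : Finset P} (hT : InfClosed (T : Set P))
    (hTS : T ⊆ S) {z : P} (hzT : z ∈ T)
    (hdom : ∀ w ∈ S, w < z → ∃ t ∈ T, w ≤ t ∧ t < z) :
    convMobius f T ⟨z, hzT⟩ = convMobius f S ⟨z, hTS hzT⟩ := by
  let least : S → T → Prop := fun w t => (w : P) ≤ t ∧ ∀ t' : T, (w : P) ≤ t' → t ≤ t'
  have least_unique : ∀ w t t', least w t → least w t' → t = t' := fun w t t' h h' =>
    le_antisymm (h.2 _ h'.1) (h'.2 _ h.1)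
  have least_exists : ∀ (w : S) (t : T), (w : P) ≤ t → ∃ t', least w t' := by
    intro w t hwt
    have hne : (T.filter fun t' => (w : P) ≤ t').Nonempty := ⟨t, by simp [hwt]⟩
    refine ⟨⟨(T.filter fun t' => (w : P) ≤ t').inf' hne id, ?_⟩, ?_, ?_⟩
    · exact Finset.inf'_mem (T : Set P) (fun x hx y hy => hT hx hy) _ hne _
        fun x hx => (Finset.mem_filter.1 hx).1
    · exact Finset.le_inf' hne _ fun x hx => (Finset.mem_filter.1 hx).2
    · intro t' ht'
      exact Finset.inf'_le (f := id) (Finset.mem_filter.2 ⟨t'.2, ht'⟩)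
  -- Group the elements of `S` by the least element of `T` above them. The grouped sums satisfy the
  -- inversion formula of `T`, so they are the convolution over `T`.
  let c : T → ℂ := fun t => ∑ w : S with least w t, convMobius f S w
  have hc : convMobius f T = c := by
    refine eq_of_sum_le_eq fun t => ?_
    rw [sum_convMobius_le]
    have := sum_convMobius_le f S ⟨t, hTS t.2⟩
    rw [← show _ = 1 / f t from this]
    simp only [c, Finset.sum_filter (fun w => least w _)]
    rw [Finset.sum_comm, Finset.sum_filter]
    refine Finset.sum_congr rfl fun w _ => ?_
    by_cases hwt : (w : P) ≤ t
    · obtain ⟨t', ht'⟩ := least_exists w t hwt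
      rw [if_pos (show w ≤ ⟨t, hTS t.2⟩ from hwt),
        Finset.sum_eq_single_of_mem t' (by simpa using ht'.2 t hwt)
          fun t'' _ hne => if_neg fun h => hne (least_unique _ _ _ h ht'), if_pos ht']
    · rw [if_neg (show ¬ w ≤ ⟨t, hTS t.2⟩ from hwt)]
      symm
      refine Finset.sum_eq_zero fun t' ht' => if_neg fun h => hwt ?_
      exact h.1.trans (by simpa using ht')
  rw [hc]
  -- An element strictly below `z` is dominated by an element of `T` strictly below `z`, so the
  -- group of `z` consists of `z` alone.
  have : (Finset.univ.filter fun w : S => least w ⟨z, hzT⟩) = {⟨z, hTS hzT⟩} := by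
    ext w
    simp only [Finset.mem_filter, Finset.mem_univ, true_and, Finset.mem_singleton]
    constructor
    · rintro ⟨h1, h2⟩
      by_contra hne
      obtain ⟨t, ht, hwt, htz⟩ := hdom w w.2 (lt_of_le_of_ne h1 fun h => hne (Subtype.ext h))
      exact htz.not_ge (h2 ⟨t, ht⟩ hwt)
    · rintro rfl
      exact ⟨le_rfl, fun t' h => h⟩
  simp only [c, this, Finset.sum_singleton]

open Classical in
/-- The join matrix of a semimultiplicative function on a meet closed set is invertible as soon as
the convolution of `1 / f` with the Möbius function does not vanish. -/
theorem isUnit_joinMatrix [DecidableEq P] {f : P → ℂ} (hf : f ∈ classF P) {S : Finset P}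
    (hS : InfClosed (S : Set P)) (h : ∀ z : S, convMobius f S z ≠ 0) :
    IsUnit (joinMatrix f S) := by
  let A : Matrix S S ℂ := Matrix.of fun z w => if w ≤ z then 1 else 0
  let D : Matrix S S ℂ := Matrix.diagonal fun z => f z
  let C : Matrix S S ℂ := Matrix.diagonal fun z => convMobius f S z
  have hA : IsUnit A := by
    rw [← Matrix.mulVec_injective_iff_isUnit]
    intro g k hgk
    refine eq_of_sum_le_eq fun z => ?_
    have := congrFun hgk z
    simpa [A, Matrix.mulVec, dotProduct, Finset.sum_filter] using this
  have hD : IsUnit D := by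
    rw [Matrix.isUnit_diagonal, Pi.isUnit_iff]
    exact fun z => (hf.2 z).isUnit
  have hC : IsUnit C := by
    rw [Matrix.isUnit_diagonal, Pi.isUnit_iff]
    exact fun z => (h z).isUnit
  have heq : joinMatrix f S = D * (A * C * A.transpose) * D := by
    ext x y
    have hsum := sum_convMobius_le f S ⟨(x : P) ⊓ y, hS x.2 y.2⟩
    have hprod := hf.1 x y
    have hne := hf.2 ((x : P) ⊓ y)
    have : (A * C * A.transpose) x y = 1 / f ((x : P) ⊓ y) := by
      rw [← show _ = 1 / f ((x : P) ⊓ y) from hsum]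
      rw [Matrix.mul_apply]
      simp only [A, C, Matrix.mul_diagonal, Matrix.transpose_apply, Matrix.of_apply,
        Finset.sum_filter]
      refine Finset.sum_congr rfl fun w _ => ?_
      have : w ≤ ⟨(x : P) ⊓ y, hS x.2 y.2⟩ ↔ w ≤ x ∧ w ≤ y := by
        rw [← Subtype.coe_le_coe]
        exact le_inf_iff
      by_cases h1 : w ≤ x <;> by_cases h2 : w ≤ y <;> simp [this, h1, h2]
    simp only [D, Matrix.mul_diagonal, Matrix.diagonal_mul, this, joinMatrix, Matrix.of_apply]
    field_simp
    rw [hprod]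
    ring
  rw [heq]
  exact (hD.mul ((hA.mul hC).mul ((Matrix.isUnit_transpose A).2 hA))).mul hD

end Convolution

/-! ### Hasse diagrams as decidable data. -/

/-- `j` is reached from `i` by at most three edges of `E`. -/
def Diagram.Below {n : ℕ} (E : Diagram n) (i j : Fin n) : Prop :=
  ∃ k l, (i = k ∨ (i, k) ∈ E) ∧ (k = l ∨ (k, l) ∈ E) ∧ (l = j ∨ (l, j) ∈ E)

instance {n : ℕ} (E : Diagram n) (i j : Fin n) : Decidable (E.Below i j) := by
  unfold Diagram.Below; infer_instance

/-- `E` is the diagram of a partial order, listed compatibly, whose greatest element is the last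
one, and its maximal chains have length at most three. -/
structure Diagram.IsHasse {n : ℕ} (E : Diagram (n + 1)) : Prop where
  lt : ∀ p ∈ E, p.1 < p.2
  below_trans : ∀ i j, E.Below i j → ∀ k, (j, k) ∈ E → E.Below i k
  not_between : ∀ p ∈ E, ∀ k, E.Below p.1 k → E.Below k p.2 → k = p.1 ∨ k = p.2

/-- Each triple `(i, j, k)` of `L` prescribes `k` as the meet of `i` and `j`, and `L` lists all
pairs of incomparable elements. -/
def Diagram.IsMeetList {n : ℕ} (E : Diagram n) (L : List (Fin n × Fin n × Fin n)) : Prop :=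
  ∀ i j, E.Below i j ∨ E.Below j i ∨
    ∃ t ∈ L, (t.1 = i ∧ t.2.1 = j ∨ t.1 = j ∧ t.2.1 = i) ∧
      E.Below t.2.2 i ∧ t.2.2 ≠ i ∧ E.Below t.2.2 j ∧ t.2.2 ≠ j

instance {n : ℕ} (E : Diagram n) (L : List (Fin n × Fin n × Fin n)) :
    Decidable (E.IsMeetList L) := by
  unfold Diagram.IsMeetList; infer_instance

/-- The integers `w i` are the values at `(i, n)` of the Möbius function of the poset
with diagram `E`. -/
def Diagram.IsWeight {n : ℕ} (E : Diagram (n + 1)) (w : Fin (n + 1) → ℤ) : Prop :=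
  ∀ k, ∑ i with E.Below k i, w i = if k = Fin.last n then 1 else 0

instance {n : ℕ} (E : Diagram (n + 1)) (w : Fin (n + 1) → ℤ) : Decidable (E.IsWeight w) := by
  unfold Diagram.IsWeight; infer_instance

/-- One triple for each unordered incomparable pair: these meets and the strict edges are all that
has to be checked in a lattice to recognize the diagram. -/
abbrev meetList35 : List (Fin 5 × Fin 5 × Fin 5) := [(1, 2, 0), (1, 3, 0), (2, 3, 0)]

abbrev meetList36 : List (Fin 6 × Fin 6 × Fin 6) :=
  [(1, 2, 0), (2, 3, 0), (2, 4, 0), (3, 4, 1)]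

abbrev meetList37 : List (Fin 7 × Fin 7 × Fin 7) :=
  [(1, 2, 0), (1, 5, 0), (2, 3, 0), (3, 4, 1), (3, 5, 0), (4, 5, 2)]

abbrev meetList46 : List (Fin 6 × Fin 6 × Fin 6) :=
  [(1, 2, 0), (1, 3, 0), (1, 4, 0), (2, 3, 0), (2, 4, 0), (3, 4, 0)]

abbrev meetList47a : List (Fin 7 × Fin 7 × Fin 7) :=
  [(1, 2, 0), (2, 3, 0), (2, 4, 0), (2, 5, 0), (3, 4, 1), (3, 5, 1), (4, 5, 1)]

abbrev meetList47b : List (Fin 7 × Fin 7 × Fin 7) :=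
  [(1, 2, 0), (1, 3, 0), (2, 3, 0), (2, 4, 0), (2, 5, 0), (3, 4, 0), (3, 5, 0), (4, 5, 1)]

abbrev meetList57 : List (Fin 7 × Fin 7 × Fin 7) :=
  [(1, 2, 0), (1, 3, 0), (1, 4, 0), (1, 5, 0), (2, 3, 0), (2, 4, 0), (2, 5, 0), (3, 4, 0),
    (3, 5, 0), (4, 5, 0)]

/-- A chain of two elements. -/
def diagram12 : Diagram 2 := {(0, 1)}

/-- Two atoms below the top. -/
def diagram24 : Diagram 4 := {(0, 1), (0, 2), (1, 3), (2, 3)}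

abbrev meetList24 : List (Fin 4 × Fin 4 × Fin 4) := [(1, 2, 0)]

theorem isHasse01 : Diagram.IsHasse (∅ : Diagram 1) := by constructor <;> decide
theorem isHasse12 : diagram12.IsHasse := by constructor <;> decide
theorem isHasse24 : diagram24.IsHasse := by constructor <;> decide +kernel
theorem isHasse35 : diagram35.IsHasse := by constructor <;> decide +kernel
theorem isHasse36 : diagram36.IsHasse := by constructor <;> decide +kernel
theorem isHasse37 : diagram37.IsHasse := by constructor <;> decide +kernel
theorem isHasse46 : diagram46.IsHasse := by constructor <;> decide +kernel
theorem isHasse47a : diagram47a.IsHasse := by constructor <;> decide +kernel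
theorem isHasse47b : diagram47b.IsHasse := by constructor <;> decide +kernel
theorem isHasse57 : diagram57.IsHasse := by constructor <;> decide +kernel

theorem isMeetList01 : Diagram.IsMeetList (∅ : Diagram 1) [] := by decide
theorem isMeetList12 : diagram12.IsMeetList [] := by decide
theorem isMeetList24 : diagram24.IsMeetList meetList24 := by decide +kernel
theorem isMeetList35 : diagram35.IsMeetList meetList35 := by decide +kernel
theorem isMeetList36 : diagram36.IsMeetList meetList36 := by decide +kernel
theorem isMeetList37 : diagram37.IsMeetList meetList37 := by decide +kernel
theorem isMeetList46 : diagram46.IsMeetList meetList46 := by decide +kernel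
theorem isMeetList47a : diagram47a.IsMeetList meetList47a := by decide +kernel
theorem isMeetList47b : diagram47b.IsMeetList meetList47b := by decide +kernel
theorem isMeetList57 : diagram57.IsMeetList meetList57 := by decide +kernel

/-- The weights are found from the top down: 1 at the last vertex, and elsewhere minus the sum of
the weights strictly above. -/
theorem isWeight01 : Diagram.IsWeight (∅ : Diagram 1) ![1] := by decide +kernel
theorem isWeight12 : diagram12.IsWeight ![-1, 1] := by decide +kernel
theorem isWeight24 : diagram24.IsWeight ![1, -1, -1, 1] := by decide +kernel
theorem isWeight35 : diagram35.IsWeight ![2, -1, -1, -1, 1] := by decide +kernel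
theorem isWeight36 : diagram36.IsWeight ![1, 1, -1, -1, -1, 1] := by decide +kernel
theorem isWeight37 : diagram37.IsWeight ![0, 1, 1, -1, -1, -1, 1] := by decide +kernel
theorem isWeight46 : diagram46.IsWeight ![3, -1, -1, -1, -1, 1] := by decide +kernel
theorem isWeight47a : diagram47a.IsWeight ![1, 2, -1, -1, -1, -1, 1] := by decide +kernel
theorem isWeight47b : diagram47b.IsWeight ![2, 1, -1, -1, -1, -1, 1] := by decide +kernel
theorem isWeight57 : diagram57.IsWeight ![4, -1, -1, -1, -1, -1, 1] := by decide +kernel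

namespace Diagram

theorem Below.refl {n : ℕ} (E : Diagram n) (i : Fin n) : E.Below i i :=
  ⟨i, i, .inl rfl, .inl rfl, .inl rfl⟩

theorem Below.lt_of_ne {n : ℕ} {E : Diagram n} {α : Type*} [PartialOrder α] {x : Fin n → α}
    (hlt : ∀ p ∈ E, x p.1 < x p.2) {i j : Fin n} (h : E.Below i j) (hij : i ≠ j) : x i < x j := by
  obtain ⟨k, l, h1, h2, h3⟩ := h
  rcases h1 with rfl | h1 <;> rcases h2 with rfl | h2 <;> rcases h3 with rfl | h3
  · exact absurd rfl hij
  · exact hlt _ h3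
  · exact hlt _ h2
  · exact (hlt _ h2).trans (hlt _ h3)
  · exact hlt _ h1
  · exact (hlt _ h1).trans (hlt _ h3)
  · exact (hlt _ h1).trans (hlt _ h2)
  · exact ((hlt _ h1).trans (hlt _ h2)).trans (hlt _ h3)

theorem Below.le {n : ℕ} {E : Diagram n} {α : Type*} [PartialOrder α] {x : Fin n → α}
    (hlt : ∀ p ∈ E, x p.1 < x p.2) {i j : Fin n} (h : E.Below i j) : x i ≤ x j := by
  by_cases hij : i = j
  · rw [hij]
  · exact (h.lt_of_ne hlt hij).le

theorem IsHasse.le_of_below {n : ℕ} {E : Diagram (n + 1)} (hE : E.IsHasse) {i j : Fin (n + 1)}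
    (h : E.Below i j) : i ≤ j :=
  h.le (x := id) hE.lt

end Diagram

/-! ### Posets with a given diagram. -/

section Labelling

variable {n : ℕ} {E : Diagram (n + 1)} {S : Finset P} {x : Fin (n + 1) ≃ S}

theorem IsLabelling.le_iff (hE : E.IsHasse) (hx : IsLabelling E x) (i j : Fin (n + 1)) :
    x i ≤ x j ↔ E.Below i j := by
  classical
  constructor
  · let _ : LocallyFiniteOrder S := Fintype.toLocallyFiniteOrder
    intro h
    rw [le_iff_reflTransGen_covBy] at h
    have : ∀ s, Relation.ReflTransGen (· ⋖ ·) (x i) s → E.Below i (x.symm s) := by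
      intro s hs
      induction hs with
      | refl => simpa using Diagram.Below.refl E i
      | @tail b c _ hbc ih =>
        refine hE.below_trans _ _ ih _ ((hx _ _).1 ?_)
        simpa using hbc
    simpa using this _ h
  · exact fun h => h.le (x := x) fun p hp => ((hx p.1 p.2).2 hp).lt

theorem IsLabelling.isAdmissible (hE : E.IsHasse) (hx : IsLabelling E x) : IsAdmissible x := by
  intro i j h
  refine lt_of_le_of_ne (hE.le_of_below ((hx.le_iff hE i j).1 h.le)) ?_
  rintro rfl
  exact h.false

/-- In an admissible listing everything below `x i` is listed before it, so an element covered at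
that stage is also covered in `S`. -/
theorem IsLabelling.methodNumber_le (hE : E.IsHasse) (hx : IsLabelling E x) (i : Fin (n + 1)) :
    methodNumber x i ≤ (Finset.univ.filter fun j => (j, i) ∈ E).card := by
  classical
  refine Finset.card_le_card fun j hj => ?_
  simp only [Finset.mem_filter, Finset.mem_univ, true_and] at hj ⊢
  obtain ⟨-, hlt, hno⟩ := hj
  rw [← hx]
  refine ⟨hlt, fun s hjs hsi => hno ⟨x.symm s, ?_, by simpa using hjs, by simpa using hsi⟩⟩
  exact (hx.isAdmissible hE _ _ (by simpa using hsi)).le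

theorem classFk_subset_classG {k : ℕ} (hE : E.IsHasse)
    (hk : ∀ i, (Finset.univ.filter fun j => (j, i) ∈ E).card ≤ k) :
    classFk P k ⊆ classG P E := fun _ hf =>
  ⟨hf.1, fun S hS x hx => hf.2 S hS _ x (hx.isAdmissible hE)
    (fun i => (hx.methodNumber_le hE i).trans (hk i)) _⟩

/-- Expand each `1 / f (x i)` by the inversion formula and exchange the sums; the defining property
of the weights leaves only the term of the last vertex. -/
theorem IsLabelling.convMobius_eq (hE : E.IsHasse) (hx : IsLabelling E x)
    {w : Fin (n + 1) → ℤ} (hw : E.IsWeight w) (f : P → ℂ) :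
    convMobius f S (x (Fin.last n)) = ∑ i, (w i : ℂ) * (1 / f (x i)) := by
  classical
  have h : ∀ i, 1 / f (x i) = ∑ k, if E.Below k i then convMobius f S (x k) else 0 := by
    intro i
    rw [← sum_convMobius_le, Finset.sum_filter, ← x.sum_comp]
    simp only [hx.le_iff hE]
  simp_rw [h, Finset.mul_sum]
  rw [Finset.sum_comm]
  have : ∀ k, ∑ i, (w i : ℂ) * (if E.Below k i then convMobius f S (x k) else 0) =
      ((∑ i with E.Below k i, w i : ℤ) : ℂ) * convMobius f S (x k) := by
    intro k
    rw [Int.cast_sum, Finset.sum_mul, Finset.sum_filter]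
    exact Finset.sum_congr rfl fun i _ => by split_ifs <;> simp
  simp_rw [this, hw _]
  simp

end Labelling

/-! ### Coatoms of an element and the room left for their meets. -/

open Classical in
/-- The elements of `S` covered by `z` in `S`, for `z ∈ S`. -/
noncomputable def coatoms (S : Finset P) (z : P) : Finset P :=
  S.filter fun c => c < z ∧ ∀ v ∈ S, v < z → ¬ c < v

section Coatoms

variable {S : Finset P} {z : P}

theorem mem_coatoms {c : P} :
    c ∈ coatoms S z ↔ c ∈ S ∧ c < z ∧ ∀ v ∈ S, v < z → ¬ c < v := by
  simp [coatoms]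

theorem mem_of_mem_coatoms {c : P} (hc : c ∈ coatoms S z) : c ∈ S := (mem_coatoms.1 hc).1

theorem lt_of_mem_coatoms {c : P} (hc : c ∈ coatoms S z) : c < z := (mem_coatoms.1 hc).2.1

theorem not_lt_of_mem_coatoms {c v : P} (hc : c ∈ coatoms S z) (hv : v ∈ S) (hvz : v < z) :
    ¬ c < v := (mem_coatoms.1 hc).2.2 v hv hvz

theorem exists_mem_coatoms_le {w : P} (hw : w ∈ S) (hwz : w < z) :
    ∃ c ∈ coatoms S z, w ≤ c := by
  classical
  obtain ⟨c, hwc, hc⟩ := (S.filter (· < z)).exists_le_maximal (Finset.mem_filter.2 ⟨hw, hwz⟩)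
  obtain ⟨hcS, hcz⟩ := Finset.mem_filter.1 hc.prop
  exact ⟨c, mem_coatoms.2 ⟨hcS, hcz, fun v hv hvz hcv =>
    hc.not_gt (Finset.mem_filter.2 ⟨hv, hvz⟩) hcv⟩, hwc⟩

theorem inf_lt_left_of_mem_coatoms {c d : P} (hc : c ∈ coatoms S z) (hd : d ∈ coatoms S z)
    (hcd : c ≠ d) : c ⊓ d < c := by
  refine inf_lt_left.2 fun h => ?_
  exact not_lt_of_mem_coatoms hc (mem_of_mem_coatoms hd) (lt_of_mem_coatoms hd)
    (lt_of_le_of_ne h hcd)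

theorem inf_lt_right_of_mem_coatoms {c d : P} (hc : c ∈ coatoms S z) (hd : d ∈ coatoms S z)
    (hcd : c ≠ d) : c ⊓ d < d :=
  (inf_comm c d).trans_lt (inf_lt_left_of_mem_coatoms hd hc hcd.symm)

open Classical in
/-- The elements of `S` that are neither `z` nor covered by `z`. -/
noncomputable def rest (S : Finset P) (z : P) : Finset P := S \ insert z (coatoms S z)

/-- Source of all size bounds: if `S` has at most seven elements, then `k` coatoms leave at most `6
- k` elements for their meets. -/
theorem card_rest_add (hz : z ∈ S) : (rest S z).card + ((coatoms S z).card + 1) = S.card := by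
  classical
  have hzC : z ∉ coatoms S z := fun h => (lt_of_mem_coatoms h).false
  rw [← Finset.card_insert_of_notMem hzC]
  refine Finset.card_sdiff_add_card_eq_card fun w hw => ?_
  rcases Finset.mem_insert.1 hw with rfl | hw
  · exact hz
  · exact mem_of_mem_coatoms hw

theorem mem_rest_of_lt {w c : P} (hw : w ∈ S) (hc : c ∈ coatoms S z) (hwc : w < c) :
    w ∈ rest S z := by
  classical
  refine Finset.mem_sdiff.2 ⟨hw, fun h => ?_⟩
  rcases Finset.mem_insert.1 h with rfl | h
  · exact (hwc.trans (lt_of_mem_coatoms hc)).false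
  · exact not_lt_of_mem_coatoms h (mem_of_mem_coatoms hc) (lt_of_mem_coatoms hc) hwc

theorem inf_mem_rest (hS : InfClosed (S : Set P)) {c d : P} (hc : c ∈ coatoms S z)
    (hd : d ∈ coatoms S z) (hcd : c ≠ d) : c ⊓ d ∈ rest S z :=
  mem_rest_of_lt (hS (mem_of_mem_coatoms hc) (mem_of_mem_coatoms hd)) hc
    (inf_lt_left_of_mem_coatoms hc hd hcd)

end Coatoms

/-! ### Recognizing a diagram inside a lattice. -/

section Realization

variable {n : ℕ} {E : Diagram (n + 1)} {L : List (Fin (n + 1) × Fin (n + 1) × Fin (n + 1))}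
  {x : Fin (n + 1) → P}

theorem inf_of_isMeetList (hL : E.IsMeetList L)
    (hlt : ∀ p ∈ E, x p.1 < x p.2) (hinf : ∀ t ∈ L, x t.1 ⊓ x t.2.1 = x t.2.2)
    (i j : Fin (n + 1)) :
    E.Below i j ∨ E.Below j i ∨ ∃ k, x i ⊓ x j = x k ∧ x k < x i ∧ x k < x j := by
  rcases hL i j with h | h | ⟨t, ht, hij, h1, h2, h3, h4⟩
  · exact .inl h
  · exact .inr (.inl h)
  · refine .inr (.inr ⟨t.2.2, ?_, h1.lt_of_ne hlt h2, h3.lt_of_ne hlt h4⟩)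
    rcases hij with ⟨rfl, rfl⟩ | ⟨rfl, rfl⟩
    · exact hinf t ht
    · rw [inf_comm]
      exact hinf t ht

/-- A listed pair has its meet strictly below both members, hence is incomparable. Distinctness and
incomparability thus come for free from the edges and the prescribed meets. -/
theorem le_iff_of_isMeetList (hL : E.IsMeetList L)
    (hlt : ∀ p ∈ E, x p.1 < x p.2) (hinf : ∀ t ∈ L, x t.1 ⊓ x t.2.1 = x t.2.2)
    (i j : Fin (n + 1)) : x i ≤ x j ↔ E.Below i j := by
  refine ⟨fun h => ?_, fun h => h.le hlt⟩
  rcases inf_of_isMeetList hL hlt hinf i j with h' | h' | ⟨k, hk, hki, -⟩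
  · exact h'
  · by_cases hij : j = i
    · exact hij ▸ Diagram.Below.refl E i
    · exact absurd h (h'.lt_of_ne hlt hij).not_ge
  · rw [← hk, inf_eq_left.2 h] at hki
    exact absurd hki (lt_irrefl _)

theorem injective_of_isMeetList (hL : E.IsMeetList L)
    (hlt : ∀ p ∈ E, x p.1 < x p.2) (hinf : ∀ t ∈ L, x t.1 ⊓ x t.2.1 = x t.2.2) :
    Function.Injective x := by
  intro i j h
  by_contra hij
  exact (((le_iff_of_isMeetList hL hlt hinf i j).1 h.le).lt_of_ne hlt hij).ne h

/-- If the elements `x i` of a finite set `S` realize the diagram `E`, and contain all elements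
of `S` covered by the last one, then the convolution does not vanish at the last one, for functions of
the class belonging to `E`. -/
theorem convMobius_ne_zero_of_realization (hE : E.IsHasse) (hL : E.IsMeetList L) {f : P → ℂ}
    (hf : f ∈ classG P E) {S : Finset P} {z : P} (hz : z ∈ S) (hxz : x (Fin.last n) = z)
    (hxS : ∀ i, x i ∈ S)
    (hlt : ∀ p ∈ E, x p.1 < x p.2) (hinf : ∀ t ∈ L, x t.1 ⊓ x t.2.1 = x t.2.2)
    (hC : ∀ c ∈ coatoms S z, ∃ i, x i = c) : convMobius f S ⟨z, hz⟩ ≠ 0 := by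
  classical
  subst hxz
  let T : Finset P := Finset.univ.image x
  have hmem : ∀ i, x i ∈ T := fun i => Finset.mem_image_of_mem x (Finset.mem_univ i)
  have hT : InfClosed (T : Set P) := by
    intro a ha b hb
    simp only [T, Finset.coe_image, Finset.coe_univ, Set.image_univ] at ha hb ⊢
    obtain ⟨i, rfl⟩ := ha
    obtain ⟨j, rfl⟩ := hb
    rcases inf_of_isMeetList hL hlt hinf i j with h | h | ⟨k, hk, -⟩
    · exact ⟨i, (inf_eq_left.2 (h.le hlt)).symm⟩
    · exact ⟨j, (inf_eq_right.2 (h.le hlt)).symm⟩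
    · exact ⟨k, hk.symm⟩
  have hinj := injective_of_isMeetList hL hlt hinf
  let e : Fin (n + 1) ≃ T := Equiv.ofBijective (fun i => ⟨x i, hmem i⟩)
    ⟨fun i j h => hinj (congrArg Subtype.val h), fun t => by
      obtain ⟨i, -, hi⟩ := Finset.mem_image.1 t.2
      exact ⟨i, Subtype.ext hi⟩⟩
  have hle : ∀ i j, e i ≤ e j ↔ E.Below i j := le_iff_of_isMeetList hL hlt hinf
  have he : IsLabelling E e := by
    intro i j
    constructor
    · intro h
      obtain ⟨k, l, h1, h2, h3⟩ := (hle i j).1 h.le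
      have hne : i ≠ j := fun hij => h.lt.ne (congrArg e hij)
      by_contra hij
      -- A path from `i` to `j` whose first proper edge ends before `j` would put an element
      -- strictly between `e i` and `e j`.
      have hno : ∀ m, (i, m) ∈ E → ¬ E.Below m j := by
        intro m him hmj
        have hmj' : m ≠ j := by rintro rfl; exact hij him
        exact h.2 (show e i < e m from hlt _ him)
          (show e m < e j from hmj.lt_of_ne hlt hmj')
      rcases h1 with rfl | h1
      · rcases h2 with rfl | h2
        · rcases h3 with rfl | h3
          · exact hne rfl
          · exact hij h3
        · exact hno l h2 ⟨l, l, .inl rfl, .inl rfl, h3⟩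
      · exact hno k h1 ⟨k, l, .inl rfl, h2, h3⟩
    · intro hij
      refine ⟨show x i < x j from hlt _ hij, fun s his hsj => ?_⟩
      obtain ⟨m, rfl⟩ := e.surjective s
      rcases hE.not_between _ hij m ((hle i m).1 his.le) ((hle m j).1 hsj.le) with h | h
      · exact his.ne (congrArg e h.symm)
      · exact hsj.ne (congrArg e h)
  have hTS : T ⊆ S := by
    intro t ht
    obtain ⟨i, -, rfl⟩ := Finset.mem_image.1 ht
    exact hxS i
  rw [← convMobius_eq_of_subset f hT hTS (hmem (Fin.last n)) fun w hw hwz => by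
    obtain ⟨c, hc, hwc⟩ := exists_mem_coatoms_le hw hwz
    obtain ⟨i, rfl⟩ := hC c hc
    exact ⟨x i, hmem i, hwc, lt_of_mem_coatoms hc⟩]
  exact hf.2 T hT e he

end Realization

/-! ### The divisibility lattice and the LCM matrix. -/

/-- The positive integers, ordered by divisibility. -/
def PosDvd : Type := {n : ℕ // 0 < n}

namespace PosDvd

instance : Lattice PosDvd where
  le a b := a.1 ∣ b.1
  le_refl a := dvd_refl a.1
  le_trans _ _ _ := dvd_trans
  le_antisymm _ _ h h' := Subtype.ext (Nat.dvd_antisymm h h')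
  sup a b := ⟨Nat.lcm a.1 b.1, Nat.lcm_pos a.2 b.2⟩
  inf a b := ⟨Nat.gcd a.1 b.1, Nat.gcd_pos_of_pos_left _ a.2⟩
  le_sup_left a b := Nat.dvd_lcm_left a.1 b.1
  le_sup_right a b := Nat.dvd_lcm_right a.1 b.1
  sup_le _ _ _ := Nat.lcm_dvd
  inf_le_left a b := Nat.gcd_dvd_left a.1 b.1
  inf_le_right a b := Nat.gcd_dvd_right a.1 b.1
  le_inf _ _ _ := Nat.dvd_gcd

theorem two_mul_le_of_lt {a b : PosDvd} (h : a < b) : 2 * a.1 ≤ b.1 := by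
  obtain ⟨c, hc⟩ : a.1 ∣ b.1 := h.le
  have hb := b.2
  have hne : a.1 ≠ b.1 := fun h' => h.ne (Subtype.ext h')
  rcases c with _ | _ | c
  · omega
  · exact absurd (by simpa using hc.symm) hne
  · nlinarith

theorem cast_mem_classF : (fun a : PosDvd => (a.1 : ℂ)) ∈ classF PosDvd :=
  ⟨fun a b => show (a.1 : ℂ) * b.1 = (Nat.gcd a.1 b.1 : ℕ) * (Nat.lcm a.1 b.1 : ℕ) by
      exact_mod_cast (Nat.gcd_mul_lcm a.1 b.1).symm,
    fun a => Nat.cast_ne_zero.2 a.2.ne'⟩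

/-- With `y i = 1 / x i`, a proper divisibility along an edge gives `2 * y p.2 ≤ y p.1`, so the
claim becomes a linear inequality over the reals. -/
theorem cast_mem_classG {n : ℕ} {E : Diagram (n + 1)} (hE : E.IsHasse) {w : Fin (n + 1) → ℤ}
    (hw : E.IsWeight w)
    (h : ∀ y : Fin (n + 1) → ℝ, (∀ i, 0 < y i) → (∀ p ∈ E, 2 * y p.2 ≤ y p.1) →
      ∑ i, (w i : ℝ) * y i ≠ 0) :
    (fun a : PosDvd => (a.1 : ℂ)) ∈ classG PosDvd E := by
  refine ⟨cast_mem_classF, fun S _ x hx => ?_⟩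
  rw [hx.convMobius_eq hE hw]
  have hpos : ∀ i, (0 : ℝ) < ((x i : PosDvd).1 : ℝ) := fun i => by
    exact_mod_cast (x i : PosDvd).2
  have := h (fun i => 1 / ((x i : PosDvd).1 : ℝ)) (fun i => one_div_pos.2 (hpos i))
    fun p hp => by
      have hlt : (x p.1 : PosDvd) < x p.2 := ((hx p.1 p.2).2 hp).lt
      have h2 : (2 : ℝ) * ((x p.1 : PosDvd).1 : ℝ) ≤ ((x p.2 : PosDvd).1 : ℝ) := by
        exact_mod_cast two_mul_le_of_lt hlt
      rw [mul_one_div, div_le_div_iff₀ (hpos _) (hpos _)]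
      linarith
  intro h0
  refine this (Complex.ofReal_injective ?_)
  push_cast
  exact h0

theorem cast_mem_classG01 : (fun a : PosDvd => (a.1 : ℂ)) ∈ classG PosDvd (∅ : Diagram 1) :=
  cast_mem_classG isHasse01 isWeight01 fun y hy _ => by
    simpa using (hy 0).ne'

/-- The two-element chain is the only one of the ten diagrams with a negative combination, `y 1 - y
0`. -/
theorem cast_mem_classG12 : (fun a : PosDvd => (a.1 : ℂ)) ∈ classG PosDvd diagram12 :=
  cast_mem_classG isHasse12 isWeight12 fun y hy h => by
    simp [diagram12] at h
    have := hy 1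
    simp [Fin.sum_univ_succ]
    exact ne_of_lt (by linarith)

theorem cast_mem_classG24 : (fun a : PosDvd => (a.1 : ℂ)) ∈ classG PosDvd diagram24 :=
  cast_mem_classG isHasse24 isWeight24 fun y hy h => by
    simp [diagram24] at h
    have := hy 3
    refine ne_of_gt ?_
    simp [Fin.sum_univ_four]
    linarith

theorem cast_mem_classG35 : (fun a : PosDvd => (a.1 : ℂ)) ∈ classG PosDvd diagram35 :=
  cast_mem_classG isHasse35 isWeight35 fun y hy h => by
    simp [diagram35] at h
    have := hy 0
    have := hy 4
    refine ne_of_gt ?_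
    simp [Fin.sum_univ_five]
    linarith

theorem cast_mem_classG36 : (fun a : PosDvd => (a.1 : ℂ)) ∈ classG PosDvd diagram36 :=
  cast_mem_classG isHasse36 isWeight36 fun y hy h => by
    simp [diagram36] at h
    have := hy 0
    have := hy 5
    refine ne_of_gt ?_
    simp [Fin.sum_univ_six]
    linarith

theorem cast_mem_classG37 : (fun a : PosDvd => (a.1 : ℂ)) ∈ classG PosDvd diagram37 :=
  cast_mem_classG isHasse37 isWeight37 fun y hy h => by
    simp [diagram37] at h
    have := hy 1
    have := hy 2
    have := hy 6
    refine ne_of_gt ?_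
    simp [Fin.sum_univ_seven]
    linarith

theorem cast_mem_classG46 : (fun a : PosDvd => (a.1 : ℂ)) ∈ classG PosDvd diagram46 :=
  cast_mem_classG isHasse46 isWeight46 fun y hy h => by
    simp [diagram46] at h
    have := hy 0
    have := hy 5
    refine ne_of_gt ?_
    simp [Fin.sum_univ_six]
    linarith

theorem cast_mem_classG47a : (fun a : PosDvd => (a.1 : ℂ)) ∈ classG PosDvd diagram47a :=
  cast_mem_classG isHasse47a isWeight47a fun y hy h => by
    simp [diagram47a] at h
    have := hy 0
    have := hy 1
    have := hy 6
    refine ne_of_gt ?_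
    simp [Fin.sum_univ_seven]
    linarith

theorem cast_mem_classG47b : (fun a : PosDvd => (a.1 : ℂ)) ∈ classG PosDvd diagram47b :=
  cast_mem_classG isHasse47b isWeight47b fun y hy h => by
    simp [diagram47b] at h
    have := hy 0
    have := hy 1
    have := hy 6
    refine ne_of_gt ?_
    simp [Fin.sum_univ_seven]
    linarith

theorem cast_mem_classG57 : (fun a : PosDvd => (a.1 : ℂ)) ∈ classG PosDvd diagram57 :=
  cast_mem_classG isHasse57 isWeight57 fun y hy h => by
    simp [diagram57] at h
    have := hy 0
    have := hy 6
    refine ne_of_gt ?_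
    simp [Fin.sum_univ_seven]
    linarith

/-- The LCM matrix of a set of positive integers is invertible if the corresponding join matrix
on the divisibility lattice is. -/
theorem isUnit_lcmMatrix [DecidableEq PosDvd] {S : Finset ℕ} (hpos : ∀ a ∈ S, 0 < a)
    {T : Finset PosDvd} (hT : ∀ a : PosDvd, a ∈ T ↔ a.1 ∈ S)
    (h : IsUnit (joinMatrix (fun a : PosDvd => (a.1 : ℂ)) T)) : IsUnit (lcmMatrix S) := by
  let e : S ≃ T :=
    { toFun := fun a => ⟨⟨a.1, hpos a.1 a.2⟩, (hT _).2 a.2⟩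
      invFun := fun b => ⟨b.1.1, (hT _).1 b.2⟩
      left_inv := fun _ => rfl
      right_inv := fun _ => rfl }
  exact (Matrix.isUnit_submatrix_equiv (A := joinMatrix (fun a : PosDvd => (a.1 : ℂ)) T) e e).2 h

end PosDvd

/-! ### Case analysis by the number of coatoms. -/

/-- The functions in the classes of all diagrams with at most seven vertices that are generated by
the elements covered by the last one. -/
structure InSmallClasses (f : P → ℂ) : Prop where
  mem01 : f ∈ classG P (∅ : Diagram 1)
  mem12 : f ∈ classG P diagram12
  mem24 : f ∈ classG P diagram24
  mem35 : f ∈ classG P diagram35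
  mem36 : f ∈ classG P diagram36
  mem37 : f ∈ classG P diagram37
  mem46 : f ∈ classG P diagram46
  mem47a : f ∈ classG P diagram47a
  mem47b : f ∈ classG P diagram47b
  mem57 : f ∈ classG P diagram57

section Cases

variable {f : P → ℂ} {S : Finset P} {z : P}

theorem convMobius_ne_zero_of_card_zero (hf : InSmallClasses f) (hz : z ∈ S)
    (hC : coatoms S z = ∅) : convMobius f S ⟨z, hz⟩ ≠ 0 := by
  refine convMobius_ne_zero_of_realization (x := ![z]) isHasse01 isMeetList01 hf.mem01 hz rfl
    (by simpa [Fin.forall_fin_succ] using hz) (by simp) (by simp) (by simp [hC])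

theorem convMobius_ne_zero_of_card_one (hf : InSmallClasses f) (hz : z ∈ S) {a : P}
    (hC : coatoms S z = {a}) : convMobius f S ⟨z, hz⟩ ≠ 0 := by
  have ha : a ∈ coatoms S z := by simp [hC]
  have haz := lt_of_mem_coatoms ha
  refine convMobius_ne_zero_of_realization (x := ![a, z]) isHasse12 isMeetList12 hf.mem12 hz rfl
    (by simp [Fin.forall_fin_succ, hz, mem_of_mem_coatoms ha]) (by simpa [diagram12] using haz)
    (by simp) ?_
  simp only [hC, Finset.mem_singleton, forall_eq]
  exact ⟨0, rfl⟩

open Classical in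
theorem convMobius_ne_zero_of_card_two (hf : InSmallClasses f) (hS : InfClosed (S : Set P))
    (hz : z ∈ S) {a b : P} (hab : a ≠ b) (hC : coatoms S z = {a, b}) :
    convMobius f S ⟨z, hz⟩ ≠ 0 := by
  have ha : a ∈ coatoms S z := by simp [hC]
  have hb : b ∈ coatoms S z := by simp [hC]
  have haS := mem_of_mem_coatoms ha
  have hbS := mem_of_mem_coatoms hb
  have haz := lt_of_mem_coatoms ha
  have hbz := lt_of_mem_coatoms hb
  refine convMobius_ne_zero_of_realization (x := ![a ⊓ b, a, b, z]) isHasse24 isMeetList24 hf.mem24 hz rfl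
    ?_ ?_ ?_ ?_
  · simpa [Fin.forall_fin_succ] using ⟨hS haS hbS, haS, hbS, hz⟩
  · simp only [diagram24, Finset.forall_mem_insert, Finset.mem_singleton, forall_eq]
    exact ⟨inf_lt_left_of_mem_coatoms ha hb hab,
      (inf_comm a b).trans_lt (inf_lt_left_of_mem_coatoms hb ha hab.symm), haz, hbz⟩
  · simp
  · simp only [hC, Finset.forall_mem_insert, Finset.mem_singleton, forall_eq]
    exact ⟨⟨1, rfl⟩, ⟨2, rfl⟩⟩

-- The common meet `a ⊓ b = a ⊓ c` lies below `b ⊓ c`: equality gives `diagram35`, strict inequality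
-- `diagram36`.
open Classical in
theorem convMobius_ne_zero_of_inf_eq_inf (hf : InSmallClasses f) (hS : InfClosed (S : Set P))
    (hz : z ∈ S) {a b c : P} (hab : a ≠ b) (hac : a ≠ c) (hbc : b ≠ c)
    (hC : coatoms S z = {a, b, c}) (h : a ⊓ b = a ⊓ c) :
    convMobius f S ⟨z, hz⟩ ≠ 0 := by
  have ha : a ∈ coatoms S z := by simp [hC]
  have hb : b ∈ coatoms S z := by simp [hC]
  have hc : c ∈ coatoms S z := by simp [hC]
  have haS := mem_of_mem_coatoms ha
  have hbS := mem_of_mem_coatoms hb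
  have hcS := mem_of_mem_coatoms hc
  have haz := lt_of_mem_coatoms ha
  have hbz := lt_of_mem_coatoms hb
  have hcz := lt_of_mem_coatoms hc
  have hgS : a ⊓ b ∈ S := hS haS hbS
  have hmS : b ⊓ c ∈ S := hS hbS hcS
  have hga : a ⊓ b < a := inf_lt_left_of_mem_coatoms ha hb hab
  have hgb : a ⊓ b < b := (inf_comm a b).trans_lt (inf_lt_left_of_mem_coatoms hb ha hab.symm)
  have hgc : a ⊓ b < c :=
    (h.trans (inf_comm a c)).trans_lt (inf_lt_left_of_mem_coatoms hc ha hac.symm)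
  have hmb : b ⊓ c < b := inf_lt_left_of_mem_coatoms hb hc hbc
  have hmc : b ⊓ c < c := (inf_comm b c).trans_lt (inf_lt_left_of_mem_coatoms hc hb hbc.symm)
  have hgm : a ⊓ b ≤ b ⊓ c := le_inf inf_le_right (h.trans_le inf_le_right)
  by_cases hm : b ⊓ c = a ⊓ b
  · refine convMobius_ne_zero_of_realization (x := ![a ⊓ b, a, b, c, z]) isHasse35 isMeetList35
      hf.mem35 hz rfl ?_ ?_ ?_ ?_
    · simpa [Fin.forall_fin_succ] using ⟨hgS, haS, hbS, hcS, hz⟩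
    · simp only [diagram35, Finset.forall_mem_insert, Finset.mem_singleton, forall_eq]
      exact ⟨hga, hgb, hgc, haz, hbz, hcz⟩
    · simp only [List.forall_mem_cons, List.not_mem_nil, false_imp_iff, implies_true,
      and_true]
      exact ⟨rfl, h.symm, hm⟩
    · simp only [hC, Finset.forall_mem_insert, Finset.mem_singleton, forall_eq]
      exact ⟨⟨1, rfl⟩, ⟨2, rfl⟩, ⟨3, rfl⟩⟩
  · refine convMobius_ne_zero_of_realization (x := ![a ⊓ b, b ⊓ c, a, b, c, z]) isHasse36
      isMeetList36 hf.mem36 hz rfl ?_ ?_ ?_ ?_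
    · simpa [Fin.forall_fin_succ] using ⟨hgS, hmS, haS, hbS, hcS, hz⟩
    · simp only [diagram36, Finset.forall_mem_insert, Finset.mem_singleton, forall_eq]
      exact ⟨lt_of_le_of_ne hgm (Ne.symm hm), hga, hmb, hmc, haz, hbz, hcz⟩
    · simp only [List.forall_mem_cons, List.not_mem_nil, false_imp_iff, implies_true,
      and_true]
      refine ⟨?_, rfl, h.symm, rfl⟩
      refine le_antisymm ?_ (le_inf hgm hga.le)
      exact le_inf inf_le_right (inf_le_left.trans inf_le_left)
    · simp only [hC, Finset.forall_mem_insert, Finset.mem_singleton, forall_eq]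
      exact ⟨⟨2, rfl⟩, ⟨3, rfl⟩, ⟨4, rfl⟩⟩

-- Here `a ⊓ c` is the meet of all three coatoms and lies strictly below the other two pairwise
-- meets, which gives `diagram37`.
open Classical in
theorem convMobius_ne_zero_of_inf_le (hf : InSmallClasses f) (hS : InfClosed (S : Set P))
    (hz : z ∈ S) {a b c : P} (hab : a ≠ b) (hbc : b ≠ c)
    (hC : coatoms S z = {a, b, c}) (h1 : a ⊓ b ≠ a ⊓ c) (h2 : a ⊓ c ≠ b ⊓ c) (h : a ⊓ c ≤ b) :
    convMobius f S ⟨z, hz⟩ ≠ 0 := by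
  have ha : a ∈ coatoms S z := by simp [hC]
  have hb : b ∈ coatoms S z := by simp [hC]
  have hc : c ∈ coatoms S z := by simp [hC]
  have haS := mem_of_mem_coatoms ha
  have hbS := mem_of_mem_coatoms hb
  have hcS := mem_of_mem_coatoms hc
  have haz := lt_of_mem_coatoms ha
  have hbz := lt_of_mem_coatoms hb
  have hcz := lt_of_mem_coatoms hc
  have h3a : a ⊓ b < a := inf_lt_left_of_mem_coatoms ha hb hab
  have h3b : a ⊓ b < b := (inf_comm a b).trans_lt (inf_lt_left_of_mem_coatoms hb ha hab.symm)
  have hmb : b ⊓ c < b := inf_lt_left_of_mem_coatoms hb hc hbc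
  have hmc : b ⊓ c < c := (inf_comm b c).trans_lt (inf_lt_left_of_mem_coatoms hc hb hbc.symm)
  have hg1 : a ⊓ c < a ⊓ b := lt_of_le_of_ne (le_inf inf_le_left h) h1.symm
  have hg2 : a ⊓ c < b ⊓ c := lt_of_le_of_ne (le_inf h inf_le_right) h2
  refine convMobius_ne_zero_of_realization (x := ![a ⊓ c, a ⊓ b, b ⊓ c, a, b, c, z]) isHasse37
    isMeetList37 hf.mem37 hz rfl ?_ ?_ ?_ ?_
  · simpa [Fin.forall_fin_succ] using ⟨hS haS hcS, hS haS hbS, hS hbS hcS, haS, hbS, hcS, hz⟩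
  · simp only [diagram37, Finset.forall_mem_insert, Finset.mem_singleton, forall_eq]
    exact ⟨hg1, hg2, h3a, h3b, hmb, hmc, haz, hbz, hcz⟩
  · simp only [List.forall_mem_cons, List.not_mem_nil, false_imp_iff, implies_true,
      and_true]
    refine ⟨?_, ?_, ?_, rfl, rfl, rfl⟩
    · exact le_antisymm (le_inf (inf_le_left.trans inf_le_left) (inf_le_right.trans inf_le_right))
        (le_inf hg1.le hg2.le)
    · exact le_antisymm (le_inf (inf_le_left.trans inf_le_left) inf_le_right)
        (le_inf hg1.le inf_le_right)
    · exact le_antisymm (le_inf inf_le_right (inf_le_left.trans inf_le_right))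
        (le_inf hg2.le inf_le_left)
  · simp only [hC, Finset.forall_mem_insert, Finset.mem_singleton, forall_eq]
    exact ⟨⟨3, rfl⟩, ⟨4, rfl⟩, ⟨5, rfl⟩⟩

open Classical in
theorem convMobius_ne_zero_of_card_three (hf : InSmallClasses f) (hS : InfClosed (S : Set P))
    (hcard : S.card ≤ 7) (hz : z ∈ S) (hC : (coatoms S z).card = 3) :
    convMobius f S ⟨z, hz⟩ ≠ 0 := by
  obtain ⟨a, b, c, hab, hac, hbc, hC'⟩ := Finset.card_eq_three.1 hC
  by_cases h1 : a ⊓ b = a ⊓ c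
  · exact convMobius_ne_zero_of_inf_eq_inf hf hS hz hab hac hbc hC' h1
  by_cases h2 : a ⊓ b = b ⊓ c
  · exact convMobius_ne_zero_of_inf_eq_inf hf hS hz hab.symm hbc hac
      (hC'.trans (Finset.insert_comm a b {c})) ((inf_comm b a).trans h2)
  by_cases h3 : a ⊓ c = b ⊓ c
  · refine convMobius_ne_zero_of_inf_eq_inf hf hS hz hac.symm hbc.symm hab
      (hC'.trans ?_) (by rw [inf_comm c a, inf_comm c b, h3])
    ext; simp; tauto
  have ha : a ∈ coatoms S z := by simp [hC']
  have hb : b ∈ coatoms S z := by simp [hC']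
  have hc : c ∈ coatoms S z := by simp [hC']
  have hsub : {a ⊓ b, a ⊓ c, b ⊓ c} ⊆ rest S z := by
    intro w hw
    simp only [Finset.mem_insert, Finset.mem_singleton] at hw
    rcases hw with rfl | rfl | rfl
    exacts [inf_mem_rest hS ha hb hab, inf_mem_rest hS ha hc hac, inf_mem_rest hS hb hc hbc]
  -- Three distinct pairwise meets exhaust the at most three remaining elements, so the triple meet
  -- is one of them, and that one lies below the third coatom.
  have heq := Finset.eq_of_subset_of_card_le hsub (by
    rw [Finset.card_eq_three.2 ⟨_, _, _, h1, h2, h3, rfl⟩]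
    have := card_rest_add hz
    omega)
  have hmem : a ⊓ b ⊓ c ∈ rest S z := by
    refine mem_rest_of_lt (hS (hS ?_ ?_) ?_) ha
      (inf_le_left.trans_lt (inf_lt_left_of_mem_coatoms ha hb hab))
    exacts [mem_of_mem_coatoms ha, mem_of_mem_coatoms hb, mem_of_mem_coatoms hc]
  rw [← heq] at hmem
  simp only [Finset.mem_insert, Finset.mem_singleton] at hmem
  rcases hmem with h | h | h
  · refine convMobius_ne_zero_of_inf_le hf hS hz (b := c) hac hbc.symm (hC'.trans ?_) (Ne.symm h1)
      (by rwa [inf_comm c b]) (h.symm.trans_le inf_le_right)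
    ext; simp; tauto
  · exact convMobius_ne_zero_of_inf_le hf hS hz hab hbc hC' h1 h3
      (h.symm.trans_le (inf_le_left.trans inf_le_right))
  · refine convMobius_ne_zero_of_inf_le hf hS hz (b := a) hab.symm hac (hC'.trans ?_)
      (by rwa [inf_comm b a]) (Ne.symm h3) (h.symm.trans_le (inf_le_left.trans inf_le_left))
    ext; simp; tauto

open Classical in
theorem convMobius_ne_zero_of_inf_eq_four (hf : InSmallClasses f) (hz : z ∈ S) {a b c d g : P}
    (hgS : g ∈ S) (hab : a ≠ b) (hcd : c ≠ d) (hC : coatoms S z = {a, b, c, d})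
    (h1 : a ⊓ b = g) (h2 : a ⊓ c = g) (h3 : a ⊓ d = g) (h4 : b ⊓ c = g) (h5 : b ⊓ d = g)
    (h6 : c ⊓ d = g) : convMobius f S ⟨z, hz⟩ ≠ 0 := by
  have ha : a ∈ coatoms S z := by simp [hC]
  have hb : b ∈ coatoms S z := by simp [hC]
  have hc : c ∈ coatoms S z := by simp [hC]
  have hd : d ∈ coatoms S z := by simp [hC]
  refine convMobius_ne_zero_of_realization (x := ![g, a, b, c, d, z]) isHasse46 isMeetList46
    hf.mem46 hz rfl ?_ ?_ ?_ ?_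
  · simpa [Fin.forall_fin_succ] using ⟨hgS, mem_of_mem_coatoms ha, mem_of_mem_coatoms hb,
      mem_of_mem_coatoms hc, mem_of_mem_coatoms hd, hz⟩
  · simp only [diagram46, Finset.forall_mem_insert, Finset.mem_singleton, forall_eq]
    exact ⟨h1.symm.trans_lt (inf_lt_left_of_mem_coatoms ha hb hab),
      h1.symm.trans_lt (inf_lt_right_of_mem_coatoms ha hb hab),
      h6.symm.trans_lt (inf_lt_left_of_mem_coatoms hc hd hcd),
      h6.symm.trans_lt (inf_lt_right_of_mem_coatoms hc hd hcd), lt_of_mem_coatoms ha,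
      lt_of_mem_coatoms hb, lt_of_mem_coatoms hc, lt_of_mem_coatoms hd⟩
  · simp only [List.forall_mem_cons, List.not_mem_nil, false_imp_iff, implies_true, and_true]
    exact ⟨h1, h2, h3, h4, h5, h6⟩
  · simp only [hC, Finset.forall_mem_insert, Finset.mem_singleton, forall_eq]
    exact ⟨⟨1, rfl⟩, ⟨2, rfl⟩, ⟨3, rfl⟩, ⟨4, rfl⟩⟩

-- Besides `z` and its four coatoms at most two elements remain. Either all pairwise meets equal the
-- total meet `g`, or there is exactly one further meet `m`, and the diagram depends only on how
-- many coatoms lie above `m`.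
open Classical in
theorem convMobius_ne_zero_of_card_four (hf : InSmallClasses f) (hS : InfClosed (S : Set P))
    (hcard : S.card ≤ 7) (hz : z ∈ S) (hC : (coatoms S z).card = 4) :
    convMobius f S ⟨z, hz⟩ ≠ 0 := by
  have hrest : (rest S z).card ≤ 2 := by
    have := card_rest_add hz
    omega
  have hne : (coatoms S z).Nonempty := Finset.card_pos.1 (by omega)
  let g := (coatoms S z).inf' hne id
  have hgS : g ∈ S :=
    Finset.inf'_mem (S : Set P) (fun x hx y hy => hS hx hy) _ hne _ fun c hc => mem_of_mem_coatoms hc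
  have hgC : ∀ c ∈ coatoms S z, g ≤ c := fun c hc => Finset.inf'_le (f := id) hc
  have hginf : ∀ c ∈ coatoms S z, ∀ d ∈ coatoms S z, g ≤ c ⊓ d := fun c hc d hd =>
    le_inf (hgC c hc) (hgC d hd)
  by_cases hall : ∀ c ∈ coatoms S z, ∀ d ∈ coatoms S z, c ≠ d → c ⊓ d = g
  · obtain ⟨a, t, hat, hat', ht⟩ := Finset.card_eq_succ.1 hC
    obtain ⟨b, c, d, hbc, hbd, hcd, rfl⟩ := Finset.card_eq_three.1 ht
    simp only [Finset.mem_insert, Finset.mem_singleton, not_or] at hat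
    have ha : a ∈ coatoms S z := by simp [← hat']
    have hb : b ∈ coatoms S z := by simp [← hat']
    have hc : c ∈ coatoms S z := by simp [← hat']
    have hd : d ∈ coatoms S z := by simp [← hat']
    exact convMobius_ne_zero_of_inf_eq_four hf hz hgS hat.1 hcd hat'.symm (hall a ha b hb hat.1)
      (hall a ha c hc hat.2.1) (hall a ha d hd hat.2.2) (hall b hb c hc hbc) (hall b hb d hd hbd)
      (hall c hc d hd hcd)
  push Not at hall
  obtain ⟨u, hu, v, hv, huv, hm⟩ := hall
  obtain ⟨m, hmuv⟩ : ∃ m, m = u ⊓ v := ⟨_, rfl⟩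
  rw [← hmuv] at hm
  have hmu : m < u := hmuv.trans_lt (inf_lt_left_of_mem_coatoms hu hv huv)
  have hmv : m < v := hmuv.trans_lt (inf_lt_right_of_mem_coatoms hu hv huv)
  have hmrest : m ∈ rest S z := hmuv ▸ inf_mem_rest hS hu hv huv
  have hmS : m ∈ S := hmuv ▸ hS (mem_of_mem_coatoms hu) (mem_of_mem_coatoms hv)
  have hgm : g < m := lt_of_le_of_ne (hmuv ▸ hginf u hu v hv) (Ne.symm hm)
  have hgrest : g ∈ rest S z := mem_rest_of_lt hgS hu (hgm.trans hmu)
  have hrest_eq : ∀ w ∈ rest S z, w = g ∨ w = m := by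
    have : {g, m} = rest S z := Finset.eq_of_subset_of_card_le
      (Finset.insert_subset hgrest (Finset.singleton_subset_iff.2 hmrest))
      (by rwa [Finset.card_pair (Ne.symm hm)])
    intro w hw
    rw [← this] at hw
    simpa using hw
  have hinf_m : ∀ c ∈ coatoms S z, ∀ d ∈ coatoms S z, c ≠ d → m ≤ c → m ≤ d → c ⊓ d = m := by
    intro c hc d hd hcd hmc hmd
    refine (hrest_eq _ (inf_mem_rest hS hc hd hcd)).resolve_left fun h => ?_
    exact (hgm.trans_le (le_inf hmc hmd)).ne h.symm
  have hinf_g : ∀ c ∈ coatoms S z, ∀ d ∈ coatoms S z, c ≠ d → ¬ m ≤ c → c ⊓ d = g := by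
    intro c hc d hd hcd hmc
    exact (hrest_eq _ (inf_mem_rest hS hc hd hcd)).resolve_right fun h => hmc (h ▸ inf_le_left)
  have hm_inf : ∀ c ∈ coatoms S z, ¬ m ≤ c → m ⊓ c = g := by
    intro c hc hmc
    have hlt : m ⊓ c < m := inf_lt_left.2 hmc
    exact (hrest_eq _ (mem_rest_of_lt (hS hmS (mem_of_mem_coatoms hc)) hu
      (hlt.trans hmu))).resolve_right hlt.ne
  have hlt_m : ∀ c ∈ coatoms S z, m ≤ c → m < c := by
    intro c hc hmc
    refine lt_of_le_of_ne hmc ?_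
    rintro rfl
    exact not_lt_of_mem_coatoms hc (mem_of_mem_coatoms hu) (lt_of_mem_coatoms hu) hmu
  have hlt_g : ∀ c ∈ coatoms S z, g < c := by
    intro c hc
    refine lt_of_le_of_ne (hgC c hc) ?_
    intro h
    exact not_lt_of_mem_coatoms hc (mem_of_mem_coatoms hu) (lt_of_mem_coatoms hu)
      (h ▸ hgm.trans hmu)
  let A := (coatoms S z).filter (m ≤ ·)
  let B := (coatoms S z).filter (¬ m ≤ ·)
  have hAB : A.card + B.card = 4 := by
    rw [← hC]
    exact Finset.card_filter_add_card_filter_not _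
  have hA : 2 ≤ A.card := by
    rw [← Finset.card_pair huv]
    refine Finset.card_le_card fun w hw => ?_
    simp only [Finset.mem_insert, Finset.mem_singleton] at hw
    rcases hw with rfl | rfl
    exacts [Finset.mem_filter.2 ⟨hu, hmu.le⟩, Finset.mem_filter.2 ⟨hv, hmv.le⟩]
  -- If all coatoms were above `m`, then so would be their meet `g`, against `g < m`.
  have hB : 1 ≤ B.card := by
    by_contra hB0
    have hB0 : B = ∅ := Finset.card_eq_zero.1 (by omega)
    have : m ≤ g := Finset.le_inf' hne _ fun c hc => by
      by_contra hmc
      exact Finset.notMem_empty c (hB0 ▸ Finset.mem_filter.2 ⟨hc, hmc⟩)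
    exact hgm.not_ge this
  have hCAB : ∀ c ∈ coatoms S z, c ∈ A ∨ c ∈ B := fun c hc => by
    by_cases hmc : m ≤ c
    · exact .inl (Finset.mem_filter.2 ⟨hc, hmc⟩)
    · exact .inr (Finset.mem_filter.2 ⟨hc, hmc⟩)
  have hAmem : ∀ c ∈ A, c ∈ coatoms S z ∧ m ≤ c := fun c hc => Finset.mem_filter.1 hc
  have hBmem : ∀ c ∈ B, c ∈ coatoms S z ∧ ¬ m ≤ c := fun c hc => Finset.mem_filter.1 hc
  have hBA : ∀ c ∈ B, ∀ d ∈ A, c ⊓ d = g := fun c hc d hd =>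
    hinf_g c (hBmem c hc).1 d (hAmem d hd).1
      (fun h => (hBmem c hc).2 (h ▸ (hAmem d hd).2)) (hBmem c hc).2
  rcases (show A.card = 3 ∧ B.card = 1 ∨ A.card = 2 ∧ B.card = 2 by omega) with
    ⟨hA3, hB1⟩ | ⟨hA2, hB2⟩
  · obtain ⟨b, c, d, hbc, hbd, hcd, hA'⟩ := Finset.card_eq_three.1 hA3
    obtain ⟨a, hB'⟩ := Finset.card_eq_one.1 hB1
    have haB : a ∈ B := by simp [hB']
    have hbA : b ∈ A := by simp [hA']
    have hcA : c ∈ A := by simp [hA']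
    have hdA : d ∈ A := by simp [hA']
    obtain ⟨ha, hma⟩ := hBmem a haB
    obtain ⟨hb, hmb⟩ := hAmem b hbA
    obtain ⟨hc, hmc⟩ := hAmem c hcA
    obtain ⟨hd, hmd⟩ := hAmem d hdA
    refine convMobius_ne_zero_of_realization (x := ![g, m, a, b, c, d, z]) isHasse47a isMeetList47a
      hf.mem47a hz rfl ?_ ?_ ?_ ?_
    · simpa [Fin.forall_fin_succ] using ⟨hgS, hmS, mem_of_mem_coatoms ha, mem_of_mem_coatoms hb,
        mem_of_mem_coatoms hc, mem_of_mem_coatoms hd, hz⟩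
    · simp only [diagram47a, Finset.forall_mem_insert, Finset.mem_singleton, forall_eq]
      exact ⟨hgm, hlt_g a ha, hlt_m b hb hmb, hlt_m c hc hmc, hlt_m d hd hmd,
        lt_of_mem_coatoms ha, lt_of_mem_coatoms hb, lt_of_mem_coatoms hc, lt_of_mem_coatoms hd⟩
    · simp only [List.forall_mem_cons, List.not_mem_nil, false_imp_iff, implies_true, and_true]
      exact ⟨hm_inf a ha hma, hBA a haB b hbA, hBA a haB c hcA, hBA a haB d hdA,
        hinf_m b hb c hc hbc hmb hmc, hinf_m b hb d hd hbd hmb hmd, hinf_m c hc d hd hcd hmc hmd⟩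
    · intro e he
      rcases hCAB e he with h | h
      · simp only [hA', Finset.mem_insert, Finset.mem_singleton] at h
        rcases h with rfl | rfl | rfl
        exacts [⟨3, rfl⟩, ⟨4, rfl⟩, ⟨5, rfl⟩]
      · simp only [hB', Finset.mem_singleton] at h
        exact ⟨2, h.symm⟩
  · obtain ⟨c, d, hcd, hA'⟩ := Finset.card_eq_two.1 hA2
    obtain ⟨a, b, hab, hB'⟩ := Finset.card_eq_two.1 hB2
    have haB : a ∈ B := by simp [hB']
    have hbB : b ∈ B := by simp [hB']
    have hcA : c ∈ A := by simp [hA']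
    have hdA : d ∈ A := by simp [hA']
    obtain ⟨ha, hma⟩ := hBmem a haB
    obtain ⟨hb, hmb⟩ := hBmem b hbB
    obtain ⟨hc, hmc⟩ := hAmem c hcA
    obtain ⟨hd, hmd⟩ := hAmem d hdA
    refine convMobius_ne_zero_of_realization (x := ![g, m, a, b, c, d, z]) isHasse47b isMeetList47b
      hf.mem47b hz rfl ?_ ?_ ?_ ?_
    · simpa [Fin.forall_fin_succ] using ⟨hgS, hmS, mem_of_mem_coatoms ha, mem_of_mem_coatoms hb,
        mem_of_mem_coatoms hc, mem_of_mem_coatoms hd, hz⟩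
    · simp only [diagram47b, Finset.forall_mem_insert, Finset.mem_singleton, forall_eq]
      exact ⟨hgm, hlt_g a ha, hlt_g b hb, hlt_m c hc hmc, hlt_m d hd hmd,
        lt_of_mem_coatoms ha, lt_of_mem_coatoms hb, lt_of_mem_coatoms hc, lt_of_mem_coatoms hd⟩
    · simp only [List.forall_mem_cons, List.not_mem_nil, false_imp_iff, implies_true, and_true]
      exact ⟨hm_inf a ha hma, hm_inf b hb hmb, hinf_g a ha b hb hab hma, hBA a haB c hcA,
        hBA a haB d hdA, hBA b hbB c hcA, hBA b hbB d hdA, hinf_m c hc d hd hcd hmc hmd⟩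
    · intro e he
      rcases hCAB e he with h | h
      · simp only [hA', Finset.mem_insert, Finset.mem_singleton] at h
        rcases h with rfl | rfl
        exacts [⟨4, rfl⟩, ⟨5, rfl⟩]
      · simp only [hB', Finset.mem_insert, Finset.mem_singleton] at h
        rcases h with rfl | rfl
        exacts [⟨2, rfl⟩, ⟨3, rfl⟩]

theorem convMobius_ne_zero_of_card_five (hf : InSmallClasses f) (hS : InfClosed (S : Set P))
    (hcard : S.card ≤ 7) (hz : z ∈ S) (hC : (coatoms S z).card = 5) :
    convMobius f S ⟨z, hz⟩ ≠ 0 := by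
  classical
  have hrest : (rest S z).card ≤ 1 := by
    have := card_rest_add hz
    omega
  let e := (coatoms S z).equivFinOfCardEq hC
  let y : Fin 5 → P := fun i => e.symm i
  have hy : ∀ i, y i ∈ coatoms S z := fun i => (e.symm i).2
  have hyne : ∀ i j, i ≠ j → y i ≠ y j := fun i j hij h => hij (e.symm.injective (Subtype.ext h))
  obtain ⟨g, hg⟩ : ∃ g, g = y 0 ⊓ y 1 := ⟨_, rfl⟩
  have hginf : ∀ i j, i ≠ j → y i ⊓ y j = g := fun i j hij =>
    hg ▸ Finset.card_le_one.1 hrest _ (inf_mem_rest hS (hy i) (hy j) (hyne i j hij)) _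
      (inf_mem_rest hS (hy 0) (hy 1) (hyne 0 1 (by decide)))
  have hgS : g ∈ S := hg ▸ hS (mem_of_mem_coatoms (hy 0)) (mem_of_mem_coatoms (hy 1))
  have hlt : ∀ i j, i ≠ j → g < y i := fun i j hij =>
    (hginf i j hij).symm.trans_lt (inf_lt_left_of_mem_coatoms (hy i) (hy j) (hyne i j hij))
  have hyS : ∀ i, y i ∈ S := fun i => mem_of_mem_coatoms (hy i)
  have hyz : ∀ i, y i < z := fun i => lt_of_mem_coatoms (hy i)
  refine convMobius_ne_zero_of_realization (x := ![g, y 0, y 1, y 2, y 3, y 4, z]) isHasse57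
    isMeetList57 hf.mem57 hz rfl ?_ ?_ ?_ ?_
  · simpa [Fin.forall_fin_succ] using ⟨hgS, hyS 0, hyS 1, hyS 2, hyS 3, hyS 4, hz⟩
  · simp only [diagram57, Finset.forall_mem_insert, Finset.mem_singleton, forall_eq]
    exact ⟨hlt 0 1 (by decide), hlt 1 0 (by decide), hlt 2 0 (by decide), hlt 3 0 (by decide),
      hlt 4 0 (by decide), hyz 0, hyz 1, hyz 2, hyz 3, hyz 4⟩
  · simp only [List.forall_mem_cons, List.not_mem_nil, false_imp_iff, implies_true, and_true]
    refine ⟨?_, ?_, ?_, ?_, ?_, ?_, ?_, ?_, ?_, ?_⟩ <;> exact hginf _ _ (by decide)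
  · intro c hc
    obtain ⟨i, hi⟩ : ∃ i, y i = c := ⟨e ⟨c, hc⟩, by simp [y]⟩
    -- Position 0 holds `g` and position 6 holds `z`, so coatom `i` sits at position `i + 1`.
    refine ⟨i.castSucc.succ, ?_⟩
    rw [← hi]
    fin_cases i <;> rfl

/-- On a meet closed set with at most seven elements, the convolution does not vanish for the
functions in all of the classes. -/
theorem convMobius_ne_zero_of_card_le (hf : InSmallClasses f) (hS : InfClosed (S : Set P))
    (hcard : S.card ≤ 7) (z : S) : convMobius f S z ≠ 0 := by
  classical
  obtain ⟨z, hz⟩ := z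
  have hadd := card_rest_add hz
  -- Six coatoms together with `z` would fill `S` and leave no place for a meet.
  have h5 : (coatoms S z).card ≤ 5 := by
    by_contra h6
    obtain ⟨c, hc, d, hd, hcd⟩ := Finset.one_lt_card.1 (show 1 < (coatoms S z).card by omega)
    have := Finset.card_pos.2 ⟨_, inf_mem_rest hS hc hd hcd⟩
    omega
  rcases (show (coatoms S z).card = 0 ∨ (coatoms S z).card = 1 ∨ (coatoms S z).card = 2 ∨
    (coatoms S z).card = 3 ∨ (coatoms S z).card = 4 ∨ (coatoms S z).card = 5 by omega) with
    h | h | h | h | h | h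
  · exact convMobius_ne_zero_of_card_zero hf hz (Finset.card_eq_zero.1 h)
  · obtain ⟨a, ha⟩ := Finset.card_eq_one.1 h
    exact convMobius_ne_zero_of_card_one hf hz ha
  · obtain ⟨a, b, hab, hC⟩ := Finset.card_eq_two.1 h
    exact convMobius_ne_zero_of_card_two hf hS hz hab (by convert hC)
  · exact convMobius_ne_zero_of_card_three hf hS hcard hz h
  · exact convMobius_ne_zero_of_card_four hf hS hcard hz h
  · exact convMobius_ne_zero_of_card_five hf hS hcard hz h

end Cases

theorem PosDvd.inSmallClasses_cast : InSmallClasses (fun a : PosDvd => (a.1 : ℂ)) :=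
  ⟨cast_mem_classG01, cast_mem_classG12, cast_mem_classG24, cast_mem_classG35, cast_mem_classG36,
    cast_mem_classG37, cast_mem_classG46, cast_mem_classG47a, cast_mem_classG47b,
    cast_mem_classG57⟩

end BourqueLigh

theorem mainTheorem1 :
    (∀ (P : Type*) [Lattice P] [DecidableEq P] (S : Finset P) (f : P → ℂ),
      InfClosed (S : Set P) → S.card = 7 →
      f ∈ BourqueLigh.classFk P 2 ∩ BourqueLigh.classG P BourqueLigh.diagram35 ∩
          BourqueLigh.classG P BourqueLigh.diagram36 ∩
          BourqueLigh.classG P BourqueLigh.diagram37 ∩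
          BourqueLigh.classG P BourqueLigh.diagram46 ∩
          BourqueLigh.classG P BourqueLigh.diagram47a ∩
          BourqueLigh.classG P BourqueLigh.diagram47b ∩
          BourqueLigh.classG P BourqueLigh.diagram57 →
      IsUnit (BourqueLigh.joinMatrix f S)) ∧
    (∀ S : Finset ℕ, (∀ a ∈ S, 0 < a) → (∀ a ∈ S, ∀ b ∈ S, Nat.gcd a b ∈ S) → S.card = 7 →
      IsUnit (BourqueLigh.lcmMatrix S)) := by
  refine ⟨fun P _ _ S f hS hcard hf => ?_, fun S hpos hgcd hcard => ?_⟩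
  · obtain ⟨⟨⟨⟨⟨⟨⟨h2, h35⟩, h36⟩, h37⟩, h46⟩, h47a⟩, h47b⟩, h57⟩ := hf
    -- `F_2` enters only through the point, the two-element chain and the diamond.
    have hsmall : BourqueLigh.InSmallClasses f :=
      ⟨BourqueLigh.classFk_subset_classG BourqueLigh.isHasse01 (by decide) h2,
        BourqueLigh.classFk_subset_classG BourqueLigh.isHasse12 (by decide) h2,
        BourqueLigh.classFk_subset_classG BourqueLigh.isHasse24 (by decide) h2,
        h35, h36, h37, h46, h47a, h47b, h57⟩
    exact BourqueLigh.isUnit_joinMatrix h2.1 hS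
      (BourqueLigh.convMobius_ne_zero_of_card_le hsmall hS hcard.le)
  -- The cast function need not be shown to lie in `F_2`; the ten diagram classes suffice.
  · classical
    let T : Finset BourqueLigh.PosDvd := Finset.subtype (0 < ·) S
    have hT : ∀ a : BourqueLigh.PosDvd, a ∈ T ↔ a.1 ∈ S := fun a => Finset.mem_subtype
    have hTinf : InfClosed (T : Set BourqueLigh.PosDvd) := fun a ha b hb =>
      (hT _).2 (hgcd _ ((hT a).1 ha) _ ((hT b).1 hb))
    have hTcard : T.card ≤ 7 := by
      rw [← hcard]
      exact (Finset.card_subtype _ S).trans_le (Finset.card_filter_le _ _)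
    exact BourqueLigh.PosDvd.isUnit_lcmMatrix hpos hT
      (BourqueLigh.isUnit_joinMatrix BourqueLigh.PosDvd.cast_mem_classF hTinf
        (BourqueLigh.convMobius_ne_zero_of_card_le BourqueLigh.PosDvd.inSmallClasses_cast
          hTinf hTcard))
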